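/- Conventions. A binary code of length $48$ is a linear subspace $C\subseteq\mathbb F_2^{48}$; $C^\perp$ is its dual for the standard bilinear form. $C$ is triply even if every codeword has weight divisible by $8$. For a code $E$ of length $48$ and $w\ge 1$, the support design $D_w(E)$ has the $48$ coordinate positions as points and the supports of all codewords of weight $w$ in $E$ as blocks. A family of $k$-subsets of the $48$ points is a $t$-design if every $t$ points lie in the same number $\lambda$ of blocks (so an empty family is a $t$-design with $\lambda=0$). Put $D_w=D_w(C)$ and $D_w^\perp=D_w(C^\perp)$. The codes considered are of the following two types. (A) Triply even codes $C$ of length $48$ whose set of weights is $\{0,16,24,32,48\}$ and whose dual $C^\perp$ has minimum weight $4$. (B) Triply even codes $C$ of length $48$ whose set of weights is $\{0,24,48\}$ and whose dual $C^\perp$ has minimum weight $2$. (Background, not part of the theorem: according to the database of Betsumiya and Munemasa there are, up to equivalence, $42$ codes of type (A) and $4$ of type (B); the one of type (A) and dimension $13$ is denoted $\langle 13,[1]\rangle$.) Theorem. Let $C$ be a code of type (A) or (B). Then $7\le\dim C\le 13$ for type (A), $2\le\dim C\le 5$ for type (B), and the following hold. (1) For every $w\ne 0$, $D_w$ and $D_w^\perp$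 are $1$-designs. (2) If $C$ is of type (A) and $\dim C\ne 13$, then $D_6^\perp$ and $D_{42}^\perp$ are $2$-designs but not $3$-designs. In all other cases the support designs are not $2$-designs, apart from the trivial ones: for every $w\notin\{0,48\}$, if $D_w$ has at least one block then it is not a $2$-design; and if $D_w^\perp$ has at least one block then it is not a $2$-design, unless $C$ is of type (A), $\dim C\neq 13$ and $w\in\{6,42\}$. -/

import Mathlib

/-- A binary linear code of length `n`: a subspace of `𝔽₂ⁿ`. The weight of a word is Mathlib's
`hammingNorm`, the number of its nonzero coordinates. -/
abbrev BinCode (n : ℕ) : Type := Submodule (ZMod 2) (Fin n → ZMod 2)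

/-- The dual code for the standard bilinear form `∑ i, x i * y i`. -/
def dualCode {n : ℕ} (C : BinCode n) : BinCode n where
  carrier := {y | ∀ x ∈ C, ∑ i, x i * y i = 0}
  zero_mem' := by
    intro x _
    simp
  add_mem' := by
    intro a b ha hb x hx
    simp only [Pi.add_apply, mul_add, Finset.sum_add_distrib]
    rw [ha x hx, hb x hx, add_zero]
  smul_mem' := by
    intro c a ha x hx
    have h : ∀ i, x i * (c • a) i = c * (x i * a i) := by
      intro i
      simp only [Pi.smul_apply, smul_eq_mul]
      ring
    simp only [h, ← Finset.mul_sum]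
    rw [ha x hx, mul_zero]

/-- Every codeword has weight divisible by `8`. -/
def IsTriplyEven {n : ℕ} (C : BinCode n) : Prop :=
  ∀ x ∈ C, 8 ∣ hammingNorm x

/-- The set of weights that occur in `C` (the weight `0` of the zero word included). -/
def weightSet {n : ℕ} (C : BinCode n) : Set ℕ :=
  {w | ∃ x ∈ C, hammingNorm x = w}

/-- `C` has a nonzero codeword, and `d` is the minimum weight of its nonzero codewords. -/
def HasMinDist {n : ℕ} (C : BinCode n) (d : ℕ) : Prop :=
  IsLeast {w | ∃ x ∈ C, x ≠ 0 ∧ hammingNorm x = w} d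

/-- The support of a word: the set of indices of its nonzero coordinates. -/
def wordSupport {n : ℕ} (x : Fin n → ZMod 2) : Finset (Fin n) :=
  Finset.univ.filter fun i => x i ≠ 0

open Classical in
/-- The blocks of the support design of weight `w`: the supports of all codewords of weight `w`. -/
noncomputable def supportBlocks {n : ℕ} (C : BinCode n) (w : ℕ) : Finset (Finset (Fin n)) :=
  (Finset.univ.filter fun x : Fin n → ZMod 2 => x ∈ C ∧ hammingNorm x = w).image wordSupport

/-- `B` is the block set of a `t`-`(n, k, lam)` design on the point set `Fin n`, for some `lam`:
all blocks have `k` points, and every `t` points lie together in precisely `lam` blocks. -/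
def IsDesign {n : ℕ} (t k : ℕ) (B : Finset (Finset (Fin n))) : Prop :=
  (∀ b ∈ B, b.card = k) ∧
    ∃ lam : ℕ, ∀ T : Finset (Fin n), T.card = t → (B.filter fun b => T ⊆ b).card = lam

/-- List (A): the triply even codes of length `48` with weights `0, 16, 24, 32, 48` whose dual has
minimum weight `4`. -/
structure IsListA (C : BinCode 48) : Prop where
  triplyEven : IsTriplyEven C
  weights : weightSet C = {0, 16, 24, 32, 48}
  dualDist : HasMinDist (dualCode C) 4

/-- List (B): the triply even codes of length `48` with weights `0, 24, 48` whose dual has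
minimum weight `2`. -/
structure IsListB (C : BinCode 48) : Prop where
  triplyEven : IsTriplyEven C
  weights : weightSet C = {0, 24, 48}
  dualDist : HasMinDist (dualCode C) 2

/-! Everything is read off the signed counts `signSum D w T`, the sums of ∏_{i∈T} (-1)^{x_i} over
the words of weight w. They determine how many blocks contain T and, through a refined MacWilliams
identity, the same numbers for the dual. The all-one word lies in C, so weights w and 48 - w have
equal signed counts up to (-1)^|T|. With character orthogonality this fixes the counts at single
points, hence the 1-designs. In type (A) it also expresses the weight distribution through |C| and
leaves one unknown per pair, `signSum D 16 {i, j}`. Between two pairs, the dual enumerators of type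
(A) differ by a multiple of a fixed polynomial (`IsListA.supportEnum_sub`). Among weights 4, 6, ...,
44 its coefficients vanish exactly at 6 and 42, which gives the 2-designs there. A 2-design in any
other nonempty class would make D_16 a 2-design, and divisibility by 47 forbids that. In dimension
13 the classes 6 and 42 are empty. In type (B) equal and unequal coordinate pairs both exist, and
their dual enumerators differ at every even weight from 2 to 46. -/

section SupportDesigns

open Finset Polynomial

/-! ### The sign character of `𝔽₂` -/

/-- The nontrivial character of `𝔽₂` with values in `ℤ`. -/
def binSign (a : ZMod 2) : ℤ := if a = 0 then 1 else -1

lemma binSign_zero : binSign 0 = 1 := rfl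

lemma binSign_add (a b : ZMod 2) : binSign (a + b) = binSign a * binSign b := by
  revert a b; decide

lemma binSign_mul_self (a : ZMod 2) : binSign a * binSign a = 1 := by
  revert a; decide

lemma binSign_sum {ι : Type*} (s : Finset ι) (f : ι → ZMod 2) :
    binSign (∑ i ∈ s, f i) = ∏ i ∈ s, binSign (f i) := by
  classical
  induction s using Finset.induction_on with
  | empty => simp [binSign_zero]
  | insert a s ha ih => rw [sum_insert ha, prod_insert ha, binSign_add, ih]

lemma sum_binSign {n : ℕ} (x : Fin n → ZMod 2) :
    ∑ i, binSign (x i) = n - 2 * (hammingNorm x : ℤ) := by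
  have h : ∀ a : ZMod 2, binSign a = 1 - 2 * (if a ≠ 0 then 1 else 0) := by decide
  simp only [h, sum_sub_distrib, ← mul_sum, hammingNorm, sum_boole]
  simp

lemma word_add_self {n : ℕ} (x : Fin n → ZMod 2) : x + x = 0 :=
  funext fun i => CharTwo.add_self_eq_zero (x i)

/-! ### Words of a code, counts and signed counts -/

open Classical in
/-- The finite set of words of a code. -/
noncomputable def codeWords {n : ℕ} (C : BinCode n) : Finset (Fin n → ZMod 2) :=
  univ.filter (· ∈ C)

lemma mem_codeWords {n : ℕ} {C : BinCode n} {x : Fin n → ZMod 2} : x ∈ codeWords C ↔ x ∈ C := by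
  simp [codeWords]

lemma card_codeWords {n : ℕ} (C : BinCode n) :
    (codeWords C).card = 2 ^ Module.finrank (ZMod 2) C := by
  classical
  have h := Module.card_eq_pow_finrank (K := ZMod 2) (V := C)
  rw [ZMod.card] at h
  rw [← h, Fintype.card_subtype]
  congr 1

/-- The number of words of weight `w` whose support contains `T`. -/
noncomputable def supportCount {n : ℕ} (C : BinCode n) (w : ℕ) (T : Finset (Fin n)) : ℕ :=
  ((codeWords C).filter fun x => hammingNorm x = w ∧ ∀ i ∈ T, x i ≠ 0).card

/-- The sum of `∏ i ∈ T, (-1) ^ x i` over the words `x` of weight `w`. -/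
noncomputable def signSum {n : ℕ} (C : BinCode n) (w : ℕ) (T : Finset (Fin n)) : ℤ :=
  ∑ x ∈ (codeWords C).filter (fun x => hammingNorm x = w), ∏ i ∈ T, binSign (x i)

lemma wordSupport_injective {n : ℕ} :
    Function.Injective (wordSupport : (Fin n → ZMod 2) → Finset (Fin n)) := by
  intro x y h
  ext1 i
  have hi : x i ≠ 0 ↔ y i ≠ 0 := by
    simpa [wordSupport] using Finset.ext_iff.mp h i
  have key : ∀ a b : ZMod 2, (a ≠ 0 ↔ b ≠ 0) → a = b := by decide
  exact key _ _ hi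

lemma card_wordSupport {n : ℕ} (x : Fin n → ZMod 2) : (wordSupport x).card = hammingNorm x := rfl

/-- Over 𝔽₂ a word is determined by its support, so counting blocks is counting words. -/
lemma card_supportBlocks_filter {n : ℕ} (C : BinCode n) (w : ℕ) (T : Finset (Fin n)) :
    ((supportBlocks C w).filter fun b => T ⊆ b).card = supportCount C w T := by
  classical
  rw [supportBlocks, filter_image, card_image_of_injective _ wordSupport_injective, supportCount]
  congr 1
  ext x
  simp [mem_codeWords, wordSupport, subset_iff, and_assoc]

lemma card_supportBlocks {n : ℕ} (C : BinCode n) (w : ℕ) :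
    (supportBlocks C w).card = supportCount C w ∅ := by
  rw [← card_supportBlocks_filter]
  simp

lemma isDesign_supportBlocks_iff {n : ℕ} (C : BinCode n) (t w : ℕ) :
    IsDesign t w (supportBlocks C w) ↔
      ∃ lam : ℕ, ∀ T : Finset (Fin n), T.card = t → supportCount C w T = lam := by
  simp only [IsDesign, card_supportBlocks_filter]
  refine and_iff_right ?_
  intro b hb
  simp only [supportBlocks, mem_image, mem_filter, mem_univ, true_and] at hb
  obtain ⟨x, ⟨-, hx⟩, rfl⟩ := hb
  rw [card_wordSupport, hx]

/-- Double counting of the incidences between `t`-sets and blocks. -/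
lemma IsDesign.choose_mul_eq {n t k : ℕ} {B : Finset (Finset (Fin n))} (h : IsDesign t k B) :
    ∃ lam : ℕ, n.choose t * lam = B.card * k.choose t := by
  obtain ⟨hk, lam, hl⟩ := h
  refine ⟨lam, ?_⟩
  have h1 : ∑ T ∈ powersetCard t (univ : Finset (Fin n)), (B.filter fun b => T ⊆ b).card
      = n.choose t * lam := by
    rw [sum_congr rfl fun T hT => hl T (mem_powersetCard.mp hT).2]
    simp
  have h2 : ∑ b ∈ B, ((powersetCard t (univ : Finset (Fin n))).filter fun T => T ⊆ b).card
      = B.card * k.choose t := by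
    have : ∀ b ∈ B, ((powersetCard t (univ : Finset (Fin n))).filter fun T => T ⊆ b).card
        = k.choose t := by
      intro b hb
      rw [← hk b hb, ← card_powersetCard]
      congr 1
      ext T
      simp [mem_powersetCard, and_comm]
    rw [sum_congr rfl this]
    simp
  rw [← h1, ← h2]
  simp only [card_filter]
  exact sum_comm

lemma signSum_empty {n : ℕ} (C : BinCode n) (w : ℕ) :
    signSum C w ∅ = supportCount C w ∅ := by
  simp [signSum, supportCount]

lemma signSum_zero {n : ℕ} (C : BinCode n) (T : Finset (Fin n)) : signSum C 0 T = 1 := by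
  have : (codeWords C).filter (fun x => hammingNorm x = 0) = {0} := by
    ext x
    simp only [mem_filter, mem_codeWords, hammingNorm_eq_zero, mem_singleton]
    exact ⟨fun h => h.2, fun h => ⟨h ▸ C.zero_mem, h⟩⟩
  rw [signSum, this]
  simp [binSign_zero]

/-- The factor 1 - (-1)^a is 2 for a ≠ 0 and 0 otherwise, so the product detects T ⊆ supp x.
Expanding it gives inclusion-exclusion. -/
lemma two_pow_mul_supportCount {n : ℕ} (C : BinCode n) (w : ℕ) (T : Finset (Fin n)) :
    (2 : ℤ) ^ T.card * supportCount C w T =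
      ∑ x ∈ (codeWords C).filter (fun x => hammingNorm x = w), ∏ i ∈ T, (1 - binSign (x i)) := by
  have h : ∀ a : ZMod 2, 1 - binSign a = if a ≠ 0 then 2 else 0 := by decide
  have h' : ∀ x : Fin n → ZMod 2, ∏ i ∈ T, (1 - binSign (x i)) =
      if ∀ i ∈ T, x i ≠ 0 then (2 : ℤ) ^ T.card else 0 := by
    intro x
    simp only [h]
    rw [prod_ite_zero]
    simp
  simp only [h', supportCount]
  rw [← sum_filter, filter_filter, sum_const, nsmul_eq_mul, mul_comm]

lemma two_mul_supportCount_singleton {n : ℕ} (C : BinCode n) (w : ℕ) (i : Fin n) :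
    2 * (supportCount C w {i} : ℤ) = signSum C w ∅ - signSum C w {i} := by
  have h := two_pow_mul_supportCount C w {i}
  simp only [card_singleton, pow_one, prod_singleton, sum_sub_distrib] at h
  simpa [signSum] using h

lemma four_mul_supportCount_pair {n : ℕ} (C : BinCode n) (w : ℕ) {i j : Fin n} (hij : i ≠ j) :
    4 * (supportCount C w {i, j} : ℤ) =
      signSum C w ∅ - signSum C w {i} - signSum C w {j} + signSum C w {i, j} := by
  have h := two_pow_mul_supportCount C w {i, j}
  rw [card_pair hij] at h
  norm_num at h
  rw [h]
  simp only [signSum, prod_pair hij, prod_singleton, prod_empty, ← sum_sub_distrib,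
    ← sum_add_distrib]
  exact sum_congr rfl fun x _ => by ring

lemma hammingNorm_one_add {n : ℕ} (x : Fin n → ZMod 2) :
    hammingNorm (1 + x) + hammingNorm x = n := by
  have h : ∀ a : ZMod 2, 1 + a ≠ 0 ↔ ¬ a ≠ 0 := by decide
  have := card_filter_add_card_filter_not (s := (univ : Finset (Fin n))) (fun i => x i ≠ 0)
  simp only [hammingNorm, Pi.add_apply, Pi.one_apply, h]
  rw [add_comm, this]
  simp

/-- Complementation of words. -/
lemma signSum_compl {n : ℕ} {C : BinCode n} (h1 : (1 : Fin n → ZMod 2) ∈ C) {v w : ℕ}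
    (hvw : v + w = n) (T : Finset (Fin n)) :
    signSum C v T = (-1) ^ T.card * signSum C w T := by
  have hs : ∀ x : Fin n → ZMod 2, 1 + (1 + x) = x := by
    intro x
    rw [← add_assoc, word_add_self, zero_add]
  rw [signSum, signSum, mul_sum]
  refine sum_nbij' (fun x => 1 + x) (fun x => 1 + x) ?_ ?_ ?_ ?_ ?_
  · intro x hx
    simp only [mem_filter, mem_codeWords] at hx ⊢
    have := hammingNorm_one_add x
    exact ⟨C.add_mem h1 hx.1, by omega⟩
  · intro x hx
    simp only [mem_filter, mem_codeWords] at hx ⊢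
    have := hammingNorm_one_add x
    exact ⟨C.add_mem h1 hx.1, by omega⟩
  · exact fun x _ => hs x
  · exact fun x _ => hs x
  · intro x _
    rw [← prod_const, ← prod_mul_distrib]
    refine prod_congr rfl fun i _ => ?_
    have : ∀ a : ZMod 2, binSign a = -1 * binSign (1 + a) := by decide
    exact this (x i)

lemma sum_codeWords_eq_sum_weights {n : ℕ} {M : Type*} [AddCommMonoid M] {C : BinCode n}
    {W : Finset ℕ} (hW : weightSet C ⊆ W) (f : (Fin n → ZMod 2) → M) :
    ∑ x ∈ codeWords C, f x =
      ∑ w ∈ W, ∑ x ∈ (codeWords C).filter (fun x => hammingNorm x = w), f x :=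
  (sum_fiberwise_of_maps_to (fun x hx => hW ⟨x, mem_codeWords.mp hx, rfl⟩) f).symm

lemma filter_weight_eq_empty {n : ℕ} {C : BinCode n} {w : ℕ} (hw : w ∉ weightSet C) :
    (codeWords C).filter (fun x => hammingNorm x = w) = ∅ := by
  refine filter_eq_empty_iff.mpr fun x hx h => hw ⟨x, mem_codeWords.mp hx, h⟩

lemma signSum_eq_zero {n : ℕ} {C : BinCode n} {w : ℕ} (hw : w ∉ weightSet C)
    (T : Finset (Fin n)) : signSum C w T = 0 := by
  rw [signSum, filter_weight_eq_empty hw, sum_empty]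

lemma signSum_empty_pos {n : ℕ} {C : BinCode n} {w : ℕ} (hw : w ∈ weightSet C) :
    0 < signSum C w ∅ := by
  obtain ⟨x, hx, hxw⟩ := hw
  rw [signSum_empty, supportCount]
  exact_mod_cast card_pos.mpr ⟨x, by simp [mem_codeWords, hx, hxw]⟩

lemma one_mem_of_mem_weightSet {n : ℕ} {C : BinCode n} (h : n ∈ weightSet C) :
    (1 : Fin n → ZMod 2) ∈ C := by
  obtain ⟨x, hx, hxn⟩ := h
  have h0 : hammingNorm (1 + x) = 0 := by
    have := hammingNorm_one_add x
    omega
  have : x = 1 := by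
    rw [hammingNorm_eq_zero] at h0
    exact funext fun i => (CharTwo.add_eq_zero.mp (congrFun h0 i)).symm
  exact this ▸ hx

/-! ### Character sums over a code -/

lemma mem_dualCode {n : ℕ} {C : BinCode n} {y : Fin n → ZMod 2} :
    y ∈ dualCode C ↔ ∀ x ∈ C, ∑ i, x i * y i = 0 := Iff.rfl

-- If some z in C has z·y ≠ 0, translation by z permutes C and flips every sign, so the sum equals
-- its negative.
open Classical in
lemma sum_binSign_dot {n : ℕ} (C : BinCode n) (y : Fin n → ZMod 2) :
    ∑ x ∈ codeWords C, binSign (∑ i, x i * y i) =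
      if y ∈ dualCode C then ((codeWords C).card : ℤ) else 0 := by
  split_ifs with hy
  · rw [sum_congr rfl fun x hx => by rw [hy x (mem_codeWords.mp hx), binSign_zero]]
    simp
  · rw [mem_dualCode] at hy
    push Not at hy
    obtain ⟨z, hz, hzy⟩ := hy
    have hs : ∑ x ∈ codeWords C, binSign (∑ i, x i * y i) =
        ∑ x ∈ codeWords C, -binSign (∑ i, x i * y i) := by
      refine sum_nbij' (fun x => z + x) (fun x => z + x) ?_ ?_ ?_ ?_ ?_
      · exact fun x hx => mem_codeWords.mpr (C.add_mem hz (mem_codeWords.mp hx))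
      · exact fun x hx => mem_codeWords.mpr (C.add_mem hz (mem_codeWords.mp hx))
      · intro x _
        simp only [← add_assoc, word_add_self, zero_add]
      · intro x _
        simp only [← add_assoc, word_add_self, zero_add]
      · intro x _
        simp only [Pi.add_apply, add_mul, sum_add_distrib]
        have : ∀ a b : ZMod 2, a ≠ 0 → binSign b = -binSign (a + b) := by decide
        exact this _ _ hzy
    rw [sum_neg_distrib] at hs
    omega

-- Orthogonality for y = e_i + e_j, which is dual exactly when coordinates i and j agree on C.
open Classical in
lemma sum_binSign_mul_binSign {n : ℕ} (C : BinCode n) (i j : Fin n) :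
    ∑ x ∈ codeWords C, binSign (x i) * binSign (x j) =
      if ∀ x ∈ C, x i = x j then ((codeWords C).card : ℤ) else 0 := by
  have hdot : ∀ x : Fin n → ZMod 2,
      ∑ l, x l * (Pi.single i 1 + Pi.single j 1 : Fin n → ZMod 2) l = x i + x j := by
    intro x
    simp [mul_add, sum_add_distrib, Pi.single_apply]
  have h := sum_binSign_dot C (Pi.single i 1 + Pi.single j 1)
  simp only [mem_dualCode, hdot, binSign_add, CharTwo.add_eq_zero] at h
  convert h

/-! ### The weight enumerator of the dual code -/

/-- The enumerator, by weight, of the words of `E` whose support contains `T`. -/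
noncomputable def supportEnum {n : ℕ} (E : BinCode n) (T : Finset (Fin n)) : ℤ[X] :=
  ∑ y ∈ (codeWords E).filter (fun y => ∀ i ∈ T, y i ≠ 0), X ^ hammingNorm y

lemma coeff_supportEnum {n : ℕ} (E : BinCode n) (T : Finset (Fin n)) (w : ℕ) :
    (supportEnum E T).coeff w = supportCount E w T := by
  simp only [supportEnum, finsetSum_coeff, coeff_X_pow, supportCount]
  rw [sum_boole, filter_filter]
  congr 3
  ext y
  exact ⟨fun h => ⟨h.2.symm, h.1⟩, fun h => ⟨h.2, h.1.symm⟩⟩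

lemma prod_one_add_binSign {n : ℕ} (x : Fin n → ZMod 2) :
    ∏ i, (1 + C (binSign (x i)) * X : ℤ[X]) =
      (1 - X) ^ hammingNorm x * (1 + X) ^ (n - hammingNorm x) := by
  have h : ∀ a : ZMod 2, (1 + C (binSign a) * X : ℤ[X]) = if a ≠ 0 then 1 - X else 1 + X := by
    intro a
    by_cases ha : a = 0 <;> simp [binSign, ha, sub_eq_add_neg]
  simp only [h]
  rw [prod_ite, prod_const, prod_const]
  congr 2
  have := card_filter_add_card_filter_not (s := (univ : Finset (Fin n))) (fun i => x i ≠ 0)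
  rw [card_univ, Fintype.card_fin] at this
  simp only [hammingNorm]
  omega

/-- Choosing a term in factor i is choosing y_i; for i in T the term y_i = 0 is missing. -/
lemma prod_ite_eq_sum_words {n : ℕ} (T : Finset (Fin n)) (x : Fin n → ZMod 2) :
    ∏ i, (if i ∈ T then C (binSign (x i)) * X else 1 + C (binSign (x i)) * X : ℤ[X]) =
      ∑ y : Fin n → ZMod 2, if ∀ i ∈ T, y i ≠ 0 then
        C (binSign (∑ i, x i * y i)) * X ^ hammingNorm y else 0 := by
  set f : Fin n → ZMod 2 → ℤ[X] := fun i a =>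
    (if i ∈ T → a ≠ 0 then 1 else 0) * (C (binSign (x i * a)) * if a ≠ 0 then X else 1) with hf
  have hsum : ∀ i, (if i ∈ T then C (binSign (x i)) * X else 1 + C (binSign (x i)) * X : ℤ[X])
      = ∑ a : ZMod 2, f i a := by
    intro i
    have : ∑ a : ZMod 2, f i a = f i 0 + f i 1 := Fin.sum_univ_two _
    rw [this]
    by_cases hi : i ∈ T <;> simp [hf, hi, binSign_zero]
  rw [prod_congr rfl fun i _ => hsum i, prod_univ_sum, Fintype.piFinset_univ]
  refine sum_congr rfl fun y _ => ?_
  simp only [hf, prod_mul_distrib]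
  rw [prod_ite_zero, binSign_sum, map_prod, prod_ite, prod_const, prod_const_one, mul_one]
  simp [hammingNorm]

/-- A refined MacWilliams identity. -/
lemma card_mul_supportEnum_dualCode {n : ℕ} (D : BinCode n) (T : Finset (Fin n)) :
    (1 - X ^ 2) ^ T.card * (C ((codeWords D).card : ℤ) * supportEnum (dualCode D) T) =
      ∑ x ∈ codeWords D, (∏ i ∈ T, (C (binSign (x i)) * X - X ^ 2)) *
        ((1 - X) ^ hammingNorm x * (1 + X) ^ (n - hammingNorm x)) := by
  classical
  have h1 : C ((codeWords D).card : ℤ) * supportEnum (dualCode D) T =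
      ∑ x ∈ codeWords D,
        ∏ i, (if i ∈ T then C (binSign (x i)) * X else 1 + C (binSign (x i)) * X : ℤ[X]) := by
    simp only [prod_ite_eq_sum_words]
    have hE : ∀ g : (Fin n → ZMod 2) → ℤ[X], ∑ y ∈ codeWords (dualCode D), g y =
        ∑ y, if y ∈ dualCode D then g y else 0 := by
      intro g
      rw [← sum_filter]
      exact sum_congr (by ext; simp [mem_codeWords]) fun _ _ => rfl
    rw [sum_comm, supportEnum, mul_sum, sum_filter, hE]
    refine sum_congr rfl fun y _ => ?_
    by_cases hT : ∀ i ∈ T, y i ≠ 0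
    · simp only [if_pos hT]
      rw [← sum_mul, ← map_sum]
      rw [sum_binSign_dot D y]
      split_ifs <;> simp
    · simp only [if_neg hT, ite_self, sum_const_zero]
  rw [h1, mul_sum]
  refine sum_congr rfl fun x _ => ?_
  -- For a sign s, s² = 1 gives (1 - X²)·sX = (sX - X²)(1 + sX). This restores the full product over
  -- all coordinates.
  have hsq : ∀ i, (C (binSign (x i)) * C (binSign (x i)) : ℤ[X]) = 1 := by
    intro i
    rw [← C_mul, binSign_mul_self, C_1]
  have hT : ∀ g : Fin n → ℤ[X], ∏ i ∈ T, g i = ∏ i, if i ∈ T then g i else 1 := by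
    intro g
    simp [prod_ite_mem]
  rw [← prod_one_add_binSign, ← prod_const, hT, hT, ← prod_mul_distrib, ← prod_mul_distrib]
  refine prod_congr rfl fun i _ => ?_
  split_ifs
  · linear_combination (-X ^ 2 : ℤ[X]) * hsq i
  · rfl

/-! ### Moments -/

lemma weightSet_subset_range {n : ℕ} (C : BinCode n) : weightSet C ⊆ range (n + 1) := by
  rintro w ⟨x, -, rfl⟩
  have : hammingNorm x ≤ Fintype.card (Fin n) := hammingNorm_le_card_fintype
  rw [Fintype.card_fin] at this
  exact mem_coe.mpr (mem_range.mpr (by omega))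

lemma sum_signSum_empty {n : ℕ} {C : BinCode n} {W : Finset ℕ} (hW : weightSet C ⊆ W) :
    ∑ w ∈ W, signSum C w ∅ = (codeWords C).card := by
  have h := sum_codeWords_eq_sum_weights hW fun _ => (1 : ℤ)
  simp only [signSum, prod_empty, ← h]
  simp

lemma sum_signSum_singleton {n : ℕ} (C : BinCode n) (w : ℕ) :
    ∑ i, signSum C w {i} = (n - 2 * w) * signSum C w ∅ := by
  simp only [signSum, prod_singleton, prod_empty]
  rw [sum_comm, mul_sum]
  refine sum_congr rfl fun x hx => ?_
  rw [sum_binSign, (mem_filter.mp hx).2, mul_one]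

-- Since n - 2 wt(x) = ∑_j (-1)^{x_j}, this first moment is a sum of pair correlations, which
-- orthogonality evaluates.
open Classical in
lemma sum_mul_signSum_singleton {n : ℕ} {C : BinCode n} {W : Finset ℕ} (hW : weightSet C ⊆ W)
    (i : Fin n) :
    ∑ w ∈ W, ((n : ℤ) - 2 * w) * signSum C w {i} =
      (codeWords C).card * (univ.filter fun j => ∀ x ∈ C, x i = x j).card := by
  have h : ∑ x ∈ codeWords C, ∑ j, binSign (x i) * binSign (x j) =
      (codeWords C).card * (univ.filter fun j => ∀ x ∈ C, x i = x j).card := by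
    rw [sum_comm]
    simp only [sum_binSign_mul_binSign]
    rw [← sum_filter, sum_const, nsmul_eq_mul, mul_comm]
  rw [← h, sum_codeWords_eq_sum_weights hW]
  refine sum_congr rfl fun w _ => ?_
  rw [signSum, mul_sum]
  refine sum_congr rfl fun x hx => ?_
  rw [← mul_sum, sum_binSign, (mem_filter.mp hx).2, prod_singleton, mul_comm]

open Classical in
lemma sum_signSum_pair {n : ℕ} {C : BinCode n} {W : Finset ℕ} (hW : weightSet C ⊆ W)
    {i j : Fin n} (hij : i ≠ j) :
    ∑ w ∈ W, signSum C w {i, j} =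
      if ∀ x ∈ C, x i = x j then ((codeWords C).card : ℤ) else 0 := by
  rw [← sum_binSign_mul_binSign, sum_codeWords_eq_sum_weights hW]
  simp only [signSum, prod_pair hij]

/-! ### The dual weight enumerators in terms of signed counts -/

lemma supportEnum_dualCode_empty {n : ℕ} {D : BinCode n} {W : Finset ℕ}
    (hW : weightSet D ⊆ W) :
    C ((codeWords D).card : ℤ) * supportEnum (dualCode D) ∅ =
      ∑ w ∈ W, C (signSum D w ∅) * ((1 - X) ^ w * (1 + X) ^ (n - w)) := by
  have h := card_mul_supportEnum_dualCode D ∅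
  simp only [card_empty, pow_zero, one_mul, prod_empty] at h
  rw [h, sum_codeWords_eq_sum_weights hW]
  refine sum_congr rfl fun w _ => ?_
  rw [signSum, map_sum, sum_mul]
  refine sum_congr rfl fun x hx => ?_
  rw [(mem_filter.mp hx).2]
  simp

lemma supportEnum_dualCode_singleton {n : ℕ} {D : BinCode n} {W : Finset ℕ}
    (hW : weightSet D ⊆ W) (i : Fin n) :
    (1 - X ^ 2) * (C ((codeWords D).card : ℤ) * supportEnum (dualCode D) {i}) =
      ∑ w ∈ W, (C (signSum D w {i}) * X - C (signSum D w ∅) * X ^ 2) *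
        ((1 - X) ^ w * (1 + X) ^ (n - w)) := by
  have h := card_mul_supportEnum_dualCode D {i}
  simp only [card_singleton, pow_one, prod_singleton] at h
  rw [h, sum_codeWords_eq_sum_weights hW]
  refine sum_congr rfl fun w _ => ?_
  simp only [signSum, map_sum, sum_mul, ← sum_sub_distrib]
  refine sum_congr rfl fun x hx => ?_
  rw [(mem_filter.mp hx).2]
  simp

lemma supportEnum_dualCode_pair {n : ℕ} {D : BinCode n} {W : Finset ℕ}
    (hW : weightSet D ⊆ W) {i j : Fin n} (hij : i ≠ j) :
    (1 - X ^ 2) ^ 2 * (C ((codeWords D).card : ℤ) * supportEnum (dualCode D) {i, j}) =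
      ∑ w ∈ W, (C (signSum D w {i, j}) * X ^ 2 -
        (C (signSum D w {i}) + C (signSum D w {j})) * X ^ 3 + C (signSum D w ∅) * X ^ 4) *
        ((1 - X) ^ w * (1 + X) ^ (n - w)) := by
  have h := card_mul_supportEnum_dualCode D {i, j}
  simp only [card_pair hij, prod_pair hij] at h
  rw [h, sum_codeWords_eq_sum_weights hW]
  refine sum_congr rfl fun w _ => ?_
  simp only [signSum, map_sum, sum_mul, ← sum_sub_distrib, ← sum_add_distrib, prod_pair hij]
  refine sum_congr rfl fun x hx => ?_
  rw [(mem_filter.mp hx).2]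
  simp only [prod_singleton, prod_empty, C_mul, C_1]
  ring

lemma one_sub_X_sq_ne_zero : (1 - X ^ 2 : ℤ[X]) ≠ 0 := by
  intro h
  simpa using congrArg (fun p => coeff p 0) h

lemma C_card_codeWords_ne_zero {n : ℕ} (D : BinCode n) :
    (C ((codeWords D).card : ℤ) : ℤ[X]) ≠ 0 := by
  rw [card_codeWords]
  simp

/-! ### Designs from constant signed counts -/

/-- If the signed counts at single points are constant, all weight classes of the code and of its
dual support `1`-designs. -/
lemma isDesign_one_of_signSum {n : ℕ} {D : BinCode n}
    (h : ∀ w i j, signSum D w {i} = signSum D w {j}) (w : ℕ) :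
    IsDesign 1 w (supportBlocks D w) ∧ IsDesign 1 w (supportBlocks (dualCode D) w) := by
  simp only [isDesign_supportBlocks_iff, card_eq_one]
  rcases isEmpty_or_nonempty (Fin n) with hn | ⟨⟨i⟩⟩
  · exact ⟨⟨0, fun T ⟨j, _⟩ => hn.elim j⟩, ⟨0, fun T ⟨j, _⟩ => hn.elim j⟩⟩
  refine ⟨⟨supportCount D w {i}, ?_⟩, ⟨supportCount (dualCode D) w {i}, ?_⟩⟩
  · rintro T ⟨j, rfl⟩
    have h1 := two_mul_supportCount_singleton D w i
    have h2 := two_mul_supportCount_singleton D w j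
    have := h w i j
    omega
  · rintro T ⟨j, rfl⟩
    have hi := supportEnum_dualCode_singleton (weightSet_subset_range D) i
    have hj := supportEnum_dualCode_singleton (weightSet_subset_range D) j
    simp only [h _ j i] at hj
    have := mul_left_cancel₀ (C_card_codeWords_ne_zero D)
      (mul_left_cancel₀ one_sub_X_sq_ne_zero (hj.trans hi.symm))
    have := congrArg (fun p => coeff p w) this
    simpa only [coeff_supportEnum, Nat.cast_inj] using this

/-- When single-point counts are constant, the terms of order 0 and 1 cancel and only the pair
counts survive. -/
lemma supportEnum_dualCode_pair_sub {n : ℕ} {D : BinCode n} {W : Finset ℕ}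
    (hW : weightSet D ⊆ W) (h : ∀ w i j, signSum D w {i} = signSum D w {j})
    {i j k l : Fin n} (hij : i ≠ j) (hkl : k ≠ l) :
    (1 - X ^ 2) ^ 2 * (C ((codeWords D).card : ℤ) *
      (supportEnum (dualCode D) {i, j} - supportEnum (dualCode D) {k, l})) =
      X ^ 2 * ∑ w ∈ W, C (signSum D w {i, j} - signSum D w {k, l}) *
        ((1 - X) ^ w * (1 + X) ^ (n - w)) := by
  rw [mul_sub, mul_sub, supportEnum_dualCode_pair hW hij, supportEnum_dualCode_pair hW hkl,
    mul_sum, ← sum_sub_distrib]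
  refine sum_congr rfl fun w _ => ?_
  rw [h w k i, h w l j, C_sub]
  ring

lemma natCast_hammingNorm {n : ℕ} (x : Fin n → ZMod 2) :
    (hammingNorm x : ZMod 2) = ∑ i, x i := by
  have h : ∀ a : ZMod 2, a = if a ≠ 0 then 1 else 0 := by decide
  rw [sum_congr rfl fun i _ => h (x i), sum_boole, hammingNorm]

lemma even_hammingNorm_of_mem_dualCode {n : ℕ} {D : BinCode n} (h1 : (1 : Fin n → ZMod 2) ∈ D)
    {y : Fin n → ZMod 2} (hy : y ∈ dualCode D) : Even (hammingNorm y) := by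
  rw [← ZMod.natCast_eq_zero_iff_even, natCast_hammingNorm]
  simpa using hy 1 h1

lemma one_mem_dualCode {n : ℕ} {D : BinCode n} (h : ∀ x ∈ D, Even (hammingNorm x)) :
    (1 : Fin n → ZMod 2) ∈ dualCode D := by
  intro x hx
  simpa [← natCast_hammingNorm] using (ZMod.natCast_eq_zero_iff_even).mpr (h x hx)

lemma exists_mem_of_supportBlocks_nonempty {n : ℕ} {E : BinCode n} {w : ℕ}
    (h : (supportBlocks E w).Nonempty) : ∃ x ∈ E, hammingNorm x = w := by
  obtain ⟨b, hb⟩ := h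
  simp only [supportBlocks, mem_image, mem_filter, mem_univ, true_and] at hb
  obtain ⟨x, hx, -⟩ := hb
  exact ⟨x, hx⟩

/-! ### Coefficients -/

lemma coeff_sq_mul_expand {p : ℤ[X]} (k m : ℕ) :
    (X ^ (2 * k) * expand ℤ 2 p).coeff (2 * (m + k)) = p.coeff m := by
  rw [mul_add, coeff_X_pow_mul', if_pos (by omega), Nat.add_sub_cancel, mul_comm,
    coeff_expand_mul two_pos]

lemma coeff_one_sub_X_pow (n k : ℕ) :
    ((1 - X : ℤ[X]) ^ n).coeff k = (-1) ^ k * (n.choose k : ℤ) := by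
  have h : (1 - X : ℤ[X]) ^ n = C ((-1) ^ n) * (X + C (-1)) ^ n := by
    rw [C_pow, ← mul_pow]
    congr 1
    simp only [C_neg, C_1]
    ring
  rw [h, coeff_C_mul, coeff_X_add_C_pow, ← mul_assoc]
  rcases lt_or_ge n k with hk | hk
  · simp [Nat.choose_eq_zero_of_lt hk]
  · obtain ⟨m, rfl⟩ := Nat.exists_eq_add_of_le hk
    rw [Nat.add_sub_cancel_left, ← pow_add, add_assoc, pow_add, ← two_mul, pow_mul]
    simp

lemma coeff_one_sub_X_pow_mul (a b m : ℕ) :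
    ((1 - X : ℤ[X]) ^ a * (1 + X) ^ b).coeff m =
      ∑ k ∈ range (m + 1), (-1) ^ k * (a.choose k : ℤ) * (b.choose (m - k) : ℤ) := by
  rw [coeff_mul, Nat.sum_antidiagonal_eq_sum_range_succ_mk]
  simp only [coeff_one_sub_X_pow, coeff_one_add_X_pow]

lemma enumerator_difference_eq :
    ((1 - X) ^ 14 * (1 + 7 * X + 7 * X ^ 2 + X ^ 3) ^ 2 : ℤ[X]) =
      ∑ i ∈ range 21, C (([1, 0, -42, 128, 301, -2688, 7176, -9088, 2002, 11648, -18876, 11648,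
        2002, -9088, 7176, -2688, 301, 128, -42, 0, 1] : List ℤ).getD i 0) * X ^ i := by
  simp only [sum_range_succ, range_zero, sum_empty]
  simp
  ring

/-- The linear coefficient is -14 + 2·7 = 0, and the polynomial is palindromic of degree 20. These
two zeros become the dual weights 6 and 42. -/
lemma enumerator_difference_coeff (m : ℕ) :
    ((1 - X) ^ 14 * (1 + 7 * X + 7 * X ^ 2 + X ^ 3) ^ 2 : ℤ[X]).coeff m = 0 ↔
      m = 1 ∨ m = 19 ∨ 20 < m := by
  rw [enumerator_difference_eq]
  simp only [finsetSum_coeff, coeff_C_mul_X_pow, sum_ite_eq, mem_range]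
  split_ifs with hm
  · interval_cases m <;> simp
  · simp; omega

/-- This and the next four are the Krawtchouk values that yield the number of dual words of weight
6. -/
lemma coeff_six_zero : ((1 - X : ℤ[X]) ^ 0 * (1 + X) ^ (48 - 0)).coeff 6 = 12271512 := by
  rw [coeff_one_sub_X_pow_mul]
  simp [sum_range_succ, Nat.choose]

lemma coeff_six_sixteen : ((1 - X : ℤ[X]) ^ 16 * (1 + X) ^ (48 - 16)).coeff 6 = -7272 := by
  rw [coeff_one_sub_X_pow_mul]
  simp [sum_range_succ, Nat.choose]

lemma coeff_six_twentyfour : ((1 - X : ℤ[X]) ^ 24 * (1 + X) ^ (48 - 24)).coeff 6 = -2024 := by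
  rw [coeff_one_sub_X_pow_mul]
  simp [sum_range_succ, Nat.choose]

lemma coeff_six_thirtytwo : ((1 - X : ℤ[X]) ^ 32 * (1 + X) ^ (48 - 32)).coeff 6 = -7272 := by
  rw [coeff_one_sub_X_pow_mul]
  simp [sum_range_succ, Nat.choose]

lemma coeff_six_fortyeight : ((1 - X : ℤ[X]) ^ 48 * (1 + X) ^ (48 - 48)).coeff 6 = 12271512 := by
  rw [coeff_one_sub_X_pow_mul]
  simp [sum_range_succ, Nat.choose]

/-! ### Codes of length `48` with weights `0, 24, 48` -/

namespace IsListB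

variable {D : BinCode 48}

lemma sum_weights {M : Type*} [AddCommMonoid M] (f : ℕ → M) :
    ∑ w ∈ ({0, 24, 48} : Finset ℕ), f w = f 0 + f 24 + f 48 := by
  rw [sum_insert (by decide), sum_pair (by decide), add_assoc]

lemma weightSet_subset (h : IsListB D) : weightSet D ⊆ (({0, 24, 48} : Finset ℕ) : Set ℕ) := by
  rw [h.weights]
  simp

lemma one_mem (h : IsListB D) : (1 : Fin 48 → ZMod 2) ∈ D :=
  one_mem_of_mem_weightSet (by simp [h.weights])

lemma signSum_fortyeight (h : IsListB D) (T : Finset (Fin 48)) :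
    signSum D 48 T = (-1) ^ T.card := by
  rw [signSum_compl h.one_mem (v := 48) (w := 0) rfl, signSum_zero, mul_one]

/-- Complementation maps weight 24 to itself and negates the sum. -/
lemma signSum_singleton (h : IsListB D) (i : Fin 48) : signSum D 24 {i} = 0 := by
  have := signSum_compl h.one_mem (v := 24) (w := 24) rfl {i}
  simp only [card_singleton, pow_one] at this
  omega

lemma signSum_singleton_eq (h : IsListB D) (w : ℕ) (i j : Fin 48) :
    signSum D w {i} = signSum D w {j} := by
  by_cases hw : w ∈ weightSet D
  · rw [h.weights] at hw
    rcases hw with rfl | rfl | rfl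
    · simp only [signSum_zero]
    · simp only [h.signSum_singleton]
    · simp only [h.signSum_fortyeight, card_singleton]
  · simp only [signSum_eq_zero hw]

lemma card_eq (h : IsListB D) : ((codeWords D).card : ℤ) = 2 + signSum D 24 ∅ := by
  rw [← sum_signSum_empty h.weightSet_subset, sum_weights, signSum_zero, h.signSum_fortyeight,
    card_empty]
  ring

open Classical in
lemma card_mul_card (h : IsListB D) (i : Fin 48) :
    (codeWords D).card * (univ.filter fun j => ∀ x ∈ D, x i = x j).card = 96 := by
  have := sum_mul_signSum_singleton h.weightSet_subset i
  rw [sum_weights, signSum_zero, h.signSum_fortyeight, card_singleton] at this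
  generalize (univ.filter fun j => ∀ x ∈ D, x i = x j).card = m at this ⊢
  push_cast at this
  zify
  linarith

lemma finrank_bounds (h : IsListB D) :
    2 ≤ Module.finrank (ZMod 2) D ∧ Module.finrank (ZMod 2) D ≤ 5 := by
  classical
  have h1 := h.card_eq
  have h2 := h.card_mul_card 0
  have h3 : 0 < signSum D 24 ∅ := signSum_empty_pos (by simp [h.weights])
  rw [card_codeWords] at h1 h2
  generalize Module.finrank (ZMod 2) D = k at *
  -- The order 2^k divides 96 and exceeds 2.
  have hk : k < 7 := (Nat.pow_lt_pow_iff_right (a := 2) (by norm_num)).mp (by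
    have := Nat.le_of_dvd (by norm_num) (Dvd.intro _ h2)
    omega)
  interval_cases k <;> omega

lemma not_isDesign_two (h : IsListB D) {w : ℕ} (h0 : w ≠ 0) (h48 : w ≠ 48)
    (hne : (supportBlocks D w).Nonempty) : ¬ IsDesign 2 w (supportBlocks D w) := by
  intro hd
  obtain ⟨x, hx, hxw⟩ := exists_mem_of_supportBlocks_nonempty hne
  have hw : w ∈ weightSet D := ⟨x, hx, hxw⟩
  rw [h.weights] at hw
  obtain rfl : w = 24 := by
    rcases hw with rfl | rfl | rfl <;> simp_all
  obtain ⟨lam, hl⟩ := hd.choose_mul_eq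
  rw [card_supportBlocks] at hl
  have hc := h.card_eq
  obtain ⟨hk1, hk2⟩ := h.finrank_bounds
  rw [signSum_empty, card_codeWords] at hc
  generalize Module.finrank (ZMod 2) D = k at *
  -- The prime 47 divides 1128 but neither 276 nor any of the block numbers 2^k - 2 with 2 ≤ k ≤ 5.
  simp only [show Nat.choose 48 2 = 1128 from rfl, show Nat.choose 24 2 = 276 from rfl] at hl
  interval_cases k <;> omega

/-- Only weight 24 contributes, and by orthogonality its two pair counts differ by |C|. -/
lemma supportEnum_sub (h : IsListB D) {i j k l : Fin 48} (hij : i ≠ j) (hkl : k ≠ l)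
    (hij' : ∀ x ∈ D, x i = x j) (hkl' : ¬ ∀ x ∈ D, x k = x l) :
    supportEnum (dualCode D) {i, j} - supportEnum (dualCode D) {k, l} =
      X ^ 2 * (1 - X ^ 2) ^ 22 := by
  have h1 := sum_signSum_pair h.weightSet_subset hij
  have h2 := sum_signSum_pair h.weightSet_subset hkl
  rw [if_pos hij'] at h1
  rw [if_neg hkl'] at h2
  have h3 := supportEnum_dualCode_pair_sub h.weightSet_subset h.signSum_singleton_eq hij hkl
  simp only [sum_weights, signSum_zero, h.signSum_fortyeight, card_pair hij, card_pair hkl,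
    sub_self, C_0, zero_mul, zero_add, add_zero] at h1 h2 h3
  have h4 : (C (signSum D 24 {i, j}) - C (signSum D 24 {k, l}) : ℤ[X]) =
      C ((codeWords D).card : ℤ) := by
    have h5 : signSum D 24 {i, j} - signSum D 24 {k, l} = (codeWords D).card := by
      linear_combination h1 - h2
    rw [← C_sub, h5]
  rw [C_sub, h4] at h3
  refine mul_left_cancel₀ (C_card_codeWords_ne_zero D)
    (mul_left_cancel₀ (pow_ne_zero 2 one_sub_X_sq_ne_zero) ?_)
  rw [h3, show (1 - X ^ 2 : ℤ[X]) = (1 - X) * (1 + X) by ring]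
  ring

lemma not_isDesign_two_dualCode (h : IsListB D) {w : ℕ} (h0 : w ≠ 0) (h48 : w ≠ 48)
    (hne : (supportBlocks (dualCode D) w).Nonempty) :
    ¬ IsDesign 2 w (supportBlocks (dualCode D) w) := by
  classical
  rw [isDesign_supportBlocks_iff]
  rintro ⟨lam, hl⟩
  obtain ⟨y, hy, rfl⟩ := exists_mem_of_supportBlocks_nonempty hne
  have hle : hammingNorm y ≤ 48 := hammingNorm_le_card_fintype
  obtain ⟨m, hm⟩ := even_hammingNorm_of_mem_dualCode h.one_mem hy
  have hc := h.card_mul_card 0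
  have hb := h.finrank_bounds
  have hq1 : 4 ≤ (codeWords D).card := by
    rw [card_codeWords]
    exact Nat.pow_le_pow_right (n := 2) (by norm_num) hb.1
  have hq2 : (codeWords D).card ≤ 32 := by
    rw [card_codeWords]
    exact Nat.pow_le_pow_right (n := 2) (by norm_num) hb.2
  set S := univ.filter fun j => ∀ x ∈ D, x 0 = x j with hS
  -- The class of coordinates equal to coordinate 0 has 96/|C| elements, between 3 and 24, so it has
  -- a second member and a nonmember.
  obtain ⟨j, hj, hj0⟩ : ∃ j ∈ S, j ≠ 0 := exists_mem_ne (by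
    by_contra! hcon
    nlinarith) 0
  obtain ⟨l, hlS⟩ : ∃ l, l ∉ S := by
    by_contra! hcon
    rw [eq_univ_iff_forall.mpr hcon, card_univ, Fintype.card_fin] at hc
    omega
  have hl0 : l ≠ 0 := by
    rintro rfl
    simp [hS] at hlS
  simp only [hS, mem_filter, mem_univ, true_and] at hj hlS
  have key := congrArg (fun p => coeff p (hammingNorm y))
    (h.supportEnum_sub hj0.symm hl0.symm hj hlS)
  simp only [coeff_sub, coeff_supportEnum, hl _ (card_pair hj0.symm), hl _ (card_pair hl0.symm),
    sub_self] at key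
  have he : (X ^ 2 * (1 - X ^ 2) ^ 22 : ℤ[X]) = X ^ (2 * 1) * expand ℤ 2 ((1 - X) ^ 22) := by
    simp
  -- Weight 2m corresponds to the coefficient of index m - 1 in (1 - Y)^22, nonzero for 1 ≤ m ≤ 23.
  rw [he, hm, show m + m = 2 * ((m - 1) + 1) by omega, coeff_sq_mul_expand,
    coeff_one_sub_X_pow] at key
  have : 0 < Nat.choose 22 (m - 1) := Nat.choose_pos (by omega)
  have h2 : (-1 : ℤ) ^ (m - 1) ≠ 0 := pow_ne_zero _ (by norm_num)
  have h3 : (Nat.choose 22 (m - 1) : ℤ) ≠ 0 := by exact_mod_cast this.ne'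
  exact mul_ne_zero h2 h3 key.symm

end IsListB

/-! ### Codes of length `48` with weights `0, 16, 24, 32, 48` and dual distance `4` -/

lemma hammingNorm_single_add_single_le {n : ℕ} (i j : Fin n) :
    hammingNorm (Pi.single i 1 + Pi.single j 1 : Fin n → ZMod 2) ≤ 2 := by
  refine (card_le_card (t := {i, j}) fun l hl => ?_).trans card_le_two
  by_contra hcon
  simp only [mem_insert, mem_singleton, not_or] at hcon
  simp [Pi.single_apply, hcon] at hl

namespace IsListA

variable {D : BinCode 48}

lemma sum_weights {M : Type*} [AddCommMonoid M] (f : ℕ → M) :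
    ∑ w ∈ ({0, 16, 24, 32, 48} : Finset ℕ), f w = f 0 + (f 16 + (f 24 + (f 32 + f 48))) := by
  rw [sum_insert (by decide), sum_insert (by decide), sum_insert (by decide),
    sum_pair (by decide)]

lemma weightSet_subset (h : IsListA D) :
    weightSet D ⊆ (({0, 16, 24, 32, 48} : Finset ℕ) : Set ℕ) := by
  rw [h.weights]
  simp

lemma one_mem (h : IsListA D) : (1 : Fin 48 → ZMod 2) ∈ D :=
  one_mem_of_mem_weightSet (by simp [h.weights])

lemma one_mem_dual (h : IsListA D) : (1 : Fin 48 → ZMod 2) ∈ dualCode D :=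
  one_mem_dualCode fun x hx => even_iff_two_dvd.mpr ((by norm_num : 2 ∣ 8).trans
    (h.triplyEven x hx))

lemma le_hammingNorm (h : IsListA D) {y : Fin 48 → ZMod 2} (hy : y ∈ dualCode D) (h0 : y ≠ 0) :
    4 ≤ hammingNorm y :=
  h.dualDist.2 ⟨y, hy, h0, rfl⟩

/-- Otherwise e_i + e_j would be a dual word of weight 2. -/
lemma not_forall_eq (h : IsListA D) {i j : Fin 48} (hij : i ≠ j) : ¬ ∀ x ∈ D, x i = x j := by
  intro hx
  have hmem : (Pi.single i 1 + Pi.single j 1 : Fin 48 → ZMod 2) ∈ dualCode D := by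
    intro x hxD
    simp [mul_add, sum_add_distrib, Pi.single_apply, hx x hxD, CharTwo.add_self_eq_zero]
  have hne : (Pi.single i 1 + Pi.single j 1 : Fin 48 → ZMod 2) ≠ 0 := by
    intro h0
    have := congrFun h0 i
    simp [hij] at this
  have := h.le_hammingNorm hmem hne
  have := hammingNorm_single_add_single_le i j
  omega

lemma signSum_fortyeight (h : IsListA D) (T : Finset (Fin 48)) :
    signSum D 48 T = (-1) ^ T.card := by
  rw [signSum_compl h.one_mem (v := 48) (w := 0) rfl, signSum_zero, mul_one]

lemma signSum_thirtytwo (h : IsListA D) (T : Finset (Fin 48)) :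
    signSum D 32 T = (-1) ^ T.card * signSum D 16 T :=
  signSum_compl h.one_mem (v := 32) (w := 16) rfl T

lemma signSum_singleton (h : IsListA D) (i : Fin 48) : signSum D 24 {i} = 0 := by
  have := signSum_compl h.one_mem (v := 24) (w := 24) rfl {i}
  simp only [card_singleton, pow_one] at this
  omega

lemma card_eq (h : IsListA D) :
    ((codeWords D).card : ℤ) = 2 + 2 * signSum D 16 ∅ + signSum D 24 ∅ := by
  rw [← sum_signSum_empty h.weightSet_subset, sum_weights, signSum_zero, h.signSum_fortyeight,
    h.signSum_thirtytwo, card_empty]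
  ring

lemma card_eq_singleton (h : IsListA D) (i : Fin 48) :
    ((codeWords D).card : ℤ) = 96 + 32 * signSum D 16 {i} := by
  classical
  have hm := sum_mul_signSum_singleton h.weightSet_subset i
  have h1 : (univ.filter fun j => ∀ x ∈ D, x i = x j) = {i} := by
    ext j
    simp only [mem_filter, mem_univ, true_and, mem_singleton]
    refine ⟨fun hx => ?_, fun hj => by simp [hj]⟩
    by_contra hj
    exact h.not_forall_eq (Ne.symm hj) hx
  rw [h1, sum_weights, signSum_zero, h.signSum_fortyeight, h.signSum_thirtytwo,
    h.signSum_singleton, card_singleton] at hm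
  push_cast at hm
  linarith

lemma three_mul_card (h : IsListA D) :
    3 * ((codeWords D).card : ℤ) = 288 + 32 * signSum D 16 ∅ := by
  have h1 := sum_signSum_singleton D 16
  have h2 : ∑ _i : Fin 48, ((codeWords D).card : ℤ) = ∑ i, (96 + 32 * signSum D 16 {i}) :=
    sum_congr rfl fun i _ => h.card_eq_singleton i
  rw [sum_add_distrib, ← mul_sum, h1, sum_const, sum_const, card_univ, Fintype.card_fin] at h2
  simp only [nsmul_eq_mul] at h2
  push_cast at h2
  linarith

lemma signSum_singleton_eq (h : IsListA D) (w : ℕ) (i j : Fin 48) :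
    signSum D w {i} = signSum D w {j} := by
  have h16 : signSum D 16 {i} = signSum D 16 {j} := by
    have hi := h.card_eq_singleton i
    have hj := h.card_eq_singleton j
    linarith
  by_cases hw : w ∈ weightSet D
  · rw [h.weights] at hw
    rcases hw with rfl | rfl | rfl | rfl | rfl
    · simp only [signSum_zero]
    · exact h16
    · simp only [h.signSum_singleton]
    · simp only [h.signSum_thirtytwo, card_singleton, h16]
    · simp only [h.signSum_fortyeight, card_singleton]
  · simp only [signSum_eq_zero hw]

lemma signSum_pair (h : IsListA D) {i j : Fin 48} (hij : i ≠ j) :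
    signSum D 24 {i, j} = -2 - 2 * signSum D 16 {i, j} := by
  have h1 := sum_signSum_pair h.weightSet_subset hij
  rw [if_neg (h.not_forall_eq hij), sum_weights, signSum_zero, h.signSum_fortyeight,
    h.signSum_thirtytwo, card_pair hij] at h1
  linarith

/-- The number of dual words of weight `6`. -/
lemma card_mul_supportCount_six (h : IsListA D) :
    ((codeWords D).card : ℤ) * supportCount (dualCode D) 6 ∅ =
      24641536 - 3008 * (codeWords D).card := by
  have h1 := congrArg (fun p => coeff p 6) (supportEnum_dualCode_empty h.weightSet_subset)
  simp only [sum_weights, coeff_C_mul, coeff_add, coeff_supportEnum, coeff_six_zero,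
    coeff_six_sixteen, coeff_six_twentyfour, coeff_six_thirtytwo, coeff_six_fortyeight,
    signSum_zero, h.signSum_fortyeight, h.signSum_thirtytwo, card_empty] at h1
  -- These two relations express the numbers of words of weights 16 and 24 through |C|.
  have h2 := h.card_eq
  have h3 := h.three_mul_card
  rw [h1]
  linarith

/-- A word of weight 16 exists, so |C| > 96; the number of dual words of weight 6 is nonnegative, so
|C| ≤ 24641536/3008 = 2^13. -/
lemma finrank_bounds (h : IsListA D) :
    7 ≤ Module.finrank (ZMod 2) D ∧ Module.finrank (ZMod 2) D ≤ 13 := by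
  have h1 := h.three_mul_card
  have h2 := h.card_mul_supportCount_six
  have h3 : 0 < signSum D 16 ∅ := signSum_empty_pos (by simp [h.weights])
  have h4 : 0 ≤ ((codeWords D).card : ℤ) * supportCount (dualCode D) 6 ∅ :=
    mul_nonneg (Int.natCast_nonneg _) (Int.natCast_nonneg _)
  rw [h2] at h4
  rw [card_codeWords] at h1 h4
  generalize Module.finrank (ZMod 2) D = k at *
  have h6 : 2 ^ 6 < 2 ^ k := by omega
  have h14 : 2 ^ k < 2 ^ 14 := by omega
  have := (Nat.pow_lt_pow_iff_right (a := 2) (by norm_num)).mp h6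
  have := (Nat.pow_lt_pow_iff_right (a := 2) (by norm_num)).mp h14
  omega

lemma not_isDesign_two (h : IsListA D) {w : ℕ} (h0 : w ≠ 0) (h48 : w ≠ 48)
    (hne : (supportBlocks D w).Nonempty) : ¬ IsDesign 2 w (supportBlocks D w) := by
  intro hd
  obtain ⟨x, hx, hxw⟩ := exists_mem_of_supportBlocks_nonempty hne
  have hw : w ∈ weightSet D := ⟨x, hx, hxw⟩
  obtain ⟨lam, hl⟩ := hd.choose_mul_eq
  rw [card_supportBlocks] at hl
  zify at hl
  rw [← signSum_empty] at hl
  have hc := h.card_eq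
  have h3 := h.three_mul_card
  have h32 := h.signSum_thirtytwo ∅
  obtain ⟨hk1, hk2⟩ := h.finrank_bounds
  rw [card_codeWords] at hc h3
  rw [card_empty, pow_zero, one_mul] at h32
  generalize Module.finrank (ZMod 2) D = k at *
  rw [h.weights] at hw
  -- Again 47 divides 1128, but none of 120, 276, 496 and none of the possible block numbers.
  have c48 : Nat.choose 48 2 = 1128 := rfl
  have c16 : Nat.choose 16 2 = 120 := rfl
  have c24 : Nat.choose 24 2 = 276 := rfl
  have c32 : Nat.choose 32 2 = 496 := rfl
  rcases hw with rfl | rfl | rfl | rfl | rfl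
  · exact h0 rfl
  · rw [c48, c16] at hl
    interval_cases k <;> omega
  · rw [c48, c24] at hl
    interval_cases k <;> omega
  · rw [c48, c32, h32] at hl
    interval_cases k <;> omega
  · exact h48 rfl

lemma supportEnum_sub (h : IsListA D) {i j k l : Fin 48} (hij : i ≠ j) (hkl : k ≠ l) :
    C ((codeWords D).card : ℤ) *
      (supportEnum (dualCode D) {i, j} - supportEnum (dualCode D) {k, l}) =
      C (256 * (signSum D 16 {i, j} - signSum D 16 {k, l})) * (X ^ (2 * 2) *
        expand ℤ 2 ((1 - X) ^ 14 * (1 + 7 * X + 7 * X ^ 2 + X ^ 3) ^ 2)) := by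
  have h3 := supportEnum_dualCode_pair_sub h.weightSet_subset h.signSum_singleton_eq hij hkl
  refine mul_left_cancel₀ (pow_ne_zero 2 one_sub_X_sq_ne_zero) (h3.trans ?_)
  simp only [sum_weights, signSum_zero, h.signSum_fortyeight, h.signSum_thirtytwo,
    h.signSum_pair hij, h.signSum_pair hkl, card_pair hij, card_pair hkl]
  generalize signSum D 16 {i, j} = a
  generalize signSum D 16 {k, l} = b
  have e : expand ℤ 2 ((1 - X) ^ 14 * (1 + 7 * X + 7 * X ^ 2 + X ^ 3) ^ 2) =
      ((1 - X) * (1 + X)) ^ 14 * (1 + 7 * X ^ 2 + 7 * X ^ 4 + X ^ 6) ^ 2 := by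
    have h7 : expand ℤ 2 (7 : ℤ[X]) = 7 := map_ofNat _ 7
    simp only [map_mul, map_pow, map_add, map_sub, map_one, expand_X, h7]
    ring
  have d1 : C (-2 - 2 * a - (-2 - 2 * b)) = (-2 * (C a - C b) : ℤ[X]) := by
    simp only [C_sub, C_mul, C_neg, C_ofNat]
    ring
  have d2 : C (256 * (a - b)) = (256 * (C a - C b) : ℤ[X]) := by
    simp only [C_sub, C_mul, C_ofNat]
  -- Both sides are the square of (1 + X)^8 - (1 - X)^8 = 16X(1 + 7X² + 7X⁴ + X⁶).
  have key : (1 + X) ^ 16 + (1 - X) ^ 16 - 2 * ((1 - X) * (1 + X)) ^ 8 =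
      (256 * X ^ 2 * (1 + 7 * X ^ 2 + 7 * X ^ 4 + X ^ 6) ^ 2 : ℤ[X]) := by
    ring
  rw [e, d1, d2]
  simp only [sub_self, C_0, zero_mul, zero_add, add_zero, even_two, Even.neg_pow, one_pow,
    one_mul, C_sub]
  rw [show (1 - X ^ 2 : ℤ[X]) = (1 - X) * (1 + X) by ring]
  linear_combination ((C a - C b) * X ^ 2 * ((1 - X) * (1 + X)) ^ 16 : ℤ[X]) * key

lemma card_mul_supportCount_sub (h : IsListA D) {i j k l : Fin 48} (hij : i ≠ j) (hkl : k ≠ l)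
    (m : ℕ) :
    ((codeWords D).card : ℤ) * (supportCount (dualCode D) (2 * (m + 2)) {i, j} -
      supportCount (dualCode D) (2 * (m + 2)) {k, l}) =
      256 * (signSum D 16 {i, j} - signSum D 16 {k, l}) *
        ((1 - X) ^ 14 * (1 + 7 * X + 7 * X ^ 2 + X ^ 3) ^ 2 : ℤ[X]).coeff m := by
  have := congrArg (fun p => coeff p (2 * (m + 2))) (h.supportEnum_sub hij hkl)
  simpa only [coeff_C_mul, coeff_sub, coeff_supportEnum, coeff_sq_mul_expand] using this

lemma card_codeWords_ne_zero (D : BinCode 48) : ((codeWords D).card : ℤ) ≠ 0 := by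
  rw [card_codeWords]
  positivity

lemma isDesign_two_dualCode (h : IsListA D) {w : ℕ} (hw : w = 6 ∨ w = 42) :
    IsDesign 2 w (supportBlocks (dualCode D) w) := by
  obtain ⟨m, rfl, hm⟩ : ∃ m, w = 2 * (m + 2) ∧ (m = 1 ∨ m = 19) := by
    rcases hw with rfl | rfl
    · exact ⟨1, rfl, Or.inl rfl⟩
    · exact ⟨19, rfl, Or.inr rfl⟩
  rw [isDesign_supportBlocks_iff]
  refine ⟨supportCount (dualCode D) (2 * (m + 2)) {0, 1}, fun T hT => ?_⟩
  obtain ⟨i, j, hij, rfl⟩ := card_eq_two.mp hT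
  have h1 := h.card_mul_supportCount_sub hij (show (0 : Fin 48) ≠ 1 by decide) m
  rw [(enumerator_difference_coeff m).mpr (hm.imp_right Or.inl), mul_zero] at h1
  have h2 := (mul_eq_zero.mp h1).resolve_left (card_codeWords_ne_zero D)
  omega

lemma supportCount_dualCode_fortytwo (h : IsListA D) :
    supportCount (dualCode D) 42 ∅ = supportCount (dualCode D) 6 ∅ := by
  have := signSum_compl h.one_mem_dual (v := 42) (w := 6) rfl ∅
  rw [card_empty, pow_zero, one_mul, signSum_empty, signSum_empty] at this
  exact_mod_cast this

lemma not_isDesign_three_dualCode (h : IsListA D) (hk : Module.finrank (ZMod 2) D ≠ 13) {w : ℕ}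
    (hw : w = 6 ∨ w = 42) : ¬ IsDesign 3 w (supportBlocks (dualCode D) w) := by
  intro hd
  obtain ⟨lam, hl⟩ := hd.choose_mul_eq
  rw [card_supportBlocks] at hl
  have h6 := h.card_mul_supportCount_six
  obtain ⟨hk1, hk2⟩ := h.finrank_bounds
  rw [card_codeWords] at h6
  have h42 := h.supportCount_dualCode_fortytwo
  generalize Module.finrank (ZMod 2) D = k at *
  -- Here 47 gives no obstruction: the block number is 64·47·(2^(13-k) - 1). The prime 23 does: it
  -- divides 17296, but not 20, 11480 or this number for 7 ≤ k ≤ 12.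
  have c48 : Nat.choose 48 3 = 17296 := rfl
  have c6 : Nat.choose 6 3 = 20 := rfl
  have c42 : Nat.choose 42 3 = 11480 := rfl
  rcases hw with rfl | rfl
  · rw [c48, c6] at hl
    interval_cases k <;> omega
  · rw [c48, c42, h42] at hl
    interval_cases k <;> omega

lemma not_isDesign_two_dualCode (h : IsListA D) {w : ℕ} (h0 : w ≠ 0) (h48 : w ≠ 48)
    (hne : (supportBlocks (dualCode D) w).Nonempty)
    (hw : ¬ (Module.finrank (ZMod 2) D ≠ 13 ∧ (w = 6 ∨ w = 42))) :
    ¬ IsDesign 2 w (supportBlocks (dualCode D) w) := by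
  obtain ⟨y, hy, hyw⟩ := exists_mem_of_supportBlocks_nonempty hne
  have hle : hammingNorm y ≤ 48 := hammingNorm_le_card_fintype
  have heven := even_hammingNorm_of_mem_dualCode h.one_mem hy
  have hy4 : 4 ≤ w := by
    rw [← hyw]
    refine h.le_hammingNorm hy ?_
    rintro rfl
    exact h0 (by simpa using hyw.symm)
  -- The complement of a dual word is dual and nonzero here, so it too has weight at least 4.
  have hy44 : w ≤ 44 := by
    have h1 := hammingNorm_one_add y
    have := h.le_hammingNorm (Submodule.add_mem _ h.one_mem_dual hy) (by
      intro hcon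
      rw [hcon, hammingNorm_zero] at h1
      omega)
    omega
  obtain ⟨m, rfl⟩ : ∃ m, w = 2 * (m + 2) := by
    obtain ⟨m, hm⟩ := heven
    exact ⟨m - 2, by omega⟩
  by_cases hm : m = 1 ∨ m = 19
  -- In dimension 13 the number of dual words of weight 6 is 24641536/2^13 - 3008 = 0, so the class
  -- would be empty.
  · have hk : Module.finrank (ZMod 2) D = 13 := by
      by_contra hcon
      exact hw ⟨hcon, by omega⟩
    have h6 := h.card_mul_supportCount_six
    rw [card_codeWords, hk] at h6
    have h42 := h.supportCount_dualCode_fortytwo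
    have hpos := card_pos.mpr hne
    rw [card_supportBlocks] at hpos
    rcases hm with rfl | rfl <;> simp only [Nat.reduceAdd, Nat.reduceMul] at hpos <;> omega
  · rw [isDesign_supportBlocks_iff]
    rintro ⟨lam, hl⟩
    have h16 : (supportBlocks D 16).Nonempty := by
      rw [← card_pos, card_supportBlocks]
      have : 0 < signSum D 16 ∅ := signSum_empty_pos (by simp [h.weights])
      rw [signSum_empty] at this
      exact_mod_cast this
    -- A nonzero coefficient at m turns constant pair counts in the dual into constant pair counts
    -- at weight 16.
    refine h.not_isDesign_two (by norm_num) (by norm_num) h16 ?_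
    rw [isDesign_supportBlocks_iff]
    refine ⟨supportCount D 16 {0, 1}, fun T hT => ?_⟩
    obtain ⟨i, j, hij, rfl⟩ := card_eq_two.mp hT
    have h01 : (0 : Fin 48) ≠ 1 := by decide
    have h1 := h.card_mul_supportCount_sub hij h01 m
    rw [hl _ (card_pair hij), hl _ (card_pair h01), sub_self, mul_zero] at h1
    have hc : ((1 - X) ^ 14 * (1 + 7 * X + 7 * X ^ 2 + X ^ 3) ^ 2 : ℤ[X]).coeff m ≠ 0 := by
      rw [Ne, enumerator_difference_coeff]
      omega
    have h2 := (mul_eq_zero.mp h1.symm).resolve_right hc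
    have h3 := four_mul_supportCount_pair D 16 hij
    have h4 := four_mul_supportCount_pair D 16 h01
    have h5 := h.signSum_singleton_eq 16 i 0
    have h6 := h.signSum_singleton_eq 16 j 1
    zify
    linarith

end IsListA

end SupportDesigns

theorem mainTheorem1 (C : BinCode 48) (hC : IsListA C ∨ IsListB C) :
    -- the dimensions that occur in the two lists
    (IsListA C → 7 ≤ Module.finrank (ZMod 2) C ∧ Module.finrank (ZMod 2) C ≤ 13) ∧
    (IsListB C → 2 ≤ Module.finrank (ZMod 2) C ∧ Module.finrank (ZMod 2) C ≤ 5) ∧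
    -- all weight classes of the code and of its dual support 1-designs
    (∀ w : ℕ, w ≠ 0 →
      IsDesign 1 w (supportBlocks C w) ∧ IsDesign 1 w (supportBlocks (dualCode C) w)) ∧
    -- list (A), dimension other than 13: the two 2-designs that are not 3-designs
    (IsListA C → Module.finrank (ZMod 2) C ≠ 13 → ∀ w : ℕ, w = 6 ∨ w = 42 →
      IsDesign 2 w (supportBlocks (dualCode C) w) ∧
        ¬ IsDesign 3 w (supportBlocks (dualCode C) w)) ∧
    -- no other weight class supports a 2-design, leaving aside empty classes and the single
    -- block of all 48 points
    (∀ w : ℕ, w ≠ 0 → w ≠ 48 → (supportBlocks C w).Nonempty →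
      ¬ IsDesign 2 w (supportBlocks C w)) ∧
    (∀ w : ℕ, w ≠ 0 → w ≠ 48 → (supportBlocks (dualCode C) w).Nonempty →
      ¬ ((IsListA C ∧ Module.finrank (ZMod 2) C ≠ 13) ∧ (w = 6 ∨ w = 42)) →
      ¬ IsDesign 2 w (supportBlocks (dualCode C) w)) := by
  refine ⟨fun h => h.finrank_bounds, fun h => h.finrank_bounds, fun w _ => ?_,
    fun h hk w hw => ⟨h.isDesign_two_dualCode hw, h.not_isDesign_three_dualCode hk hw⟩,
    fun w h0 h48 hne => ?_, fun w h0 h48 hne hw => ?_⟩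
  · exact isDesign_one_of_signSum
      (hC.elim (fun h => h.signSum_singleton_eq) fun h => h.signSum_singleton_eq) w
  · exact hC.elim (fun h => h.not_isDesign_two h0 h48 hne) fun h => h.not_isDesign_two h0 h48 hne
  · exact hC.elim
      (fun h => h.not_isDesign_two_dualCode h0 h48 hne fun hcon => hw ⟨⟨h, hcon.1⟩, hcon.2⟩)
      fun h => h.not_isDesign_two_dualCode h0 h48 hne
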